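/- Let $n,d\ge 0$ be integers and $\alpha\in(0,1)$. Let $(X_i,Y_i)$, $i\in\mathbb Z$, $i\ge -n$, be i.i.d. random pairs with values in $\mathbb R^d\times\mathbb R$; those with $-n\le i\le -1$ are the initial labeled data, and $t=0,1,2,\dots$ are the online times. Let $\widehat\mu:\mathbb R^d\to\mathbb R$ be a fixed (pre-trained) measurable function and put $R_i=|Y_i-\widehat\mu(X_i)|$. For each $t\ge 0$ let $\Pi_t:\mathbb R^d\to\{0,1\}$ be a (random) measurable selection rule, and let $S_t=\Pi_t(X_t)$. Assume that the rules are decision-driven, that is, $\Pi_t$ is $\sigma(S_0,\dots,S_{t-1})$-measurable for every $t\ge0$, and that $\{\Pi_t\}_{t\ge0}$ is independent of the initial labeled data $\{(X_i,Y_i)\}_{i=-n}^{-1}$. For $t\ge 0$ let $\mathcal N_t^{\rm on}=\{0\le i\le t-1:\Pi_t(X_i)=1\}$, define the adaptive pick rule $$\Pi_t^{\rm Ada}(x)=\Pi_t(x)\prod_{i\in\mathcal N_t^{\rm on}}\mathbf 1\{\Pi_i(x)=\Pi_i(X_t)\},\qquad x\in\mathbb R^d,$$ let $\widehat{\mathcal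 C}_t=\{-n\le s\le t-1:\Pi_t^{\rm Ada}(X_s)=1\}$ be the calibration set picked from the full holdout set, and let $$\mathcal I_t^{\rm CAP}(X_t)=\big[\widehat\mu(X_t)-q_t,\ \widehat\mu(X_t)+q_t\big],$$ where $q_t$ is the $\lceil(1-\alpha)(|\widehat{\mathcal C}_t|+1)\rceil$-th smallest value of $\{R_i\}_{i\in\widehat{\mathcal C}_t}$ (counted with multiplicity), with $q_t=+\infty$, and thus $\mathcal I_t^{\rm CAP}(X_t)=\mathbb R$, if this rank exceeds $|\widehat{\mathcal C}_t|$. Then: (1) for every integer $T\ge 0$, $$\operatorname{FCR}(T)=\mathbb E\left[\frac{\sum_{t=0}^T S_t\,\mathbf 1\{Y_t\notin\mathcal I_t^{\rm CAP}(X_t)\}}{1\vee\sum_{j=0}^T S_j}\right]\le\alpha;$$ (2) for every $t\ge 0$ with $\mathbb P(S_t=1)>0$, $$\mathbb P\{Y_t\in\mathcal I_t^{\rm CAP}(X_t)\mid S_t=1\}\ge 1-\alpha.$$ -/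

import Mathlib

open MeasureTheory

noncomputable section

namespace OnlineConformal

variable {Ω 𝓧 : Type*}

/-- The decision `S_t = Π_t(X_t)` (`true` is `1`: select, `false` is `0`) for the random selection
rules `rule t ω : 𝓧 → {0, 1}` and the features `X i ω`, `i ∈ ℤ`; online times are `t = 0, 1, 2, …`
and the initial data carry negative indices. -/
def decision (rule : ℕ → Ω → 𝓧 → Bool) (X : ℤ → Ω → 𝓧) (t : ℕ) (ω : Ω) : Bool :=
  rule t ω (X t ω)

/-- The `σ`-field `σ(S_0, …, S_{t-1})` on `Ω`. -/
abbrev decisionSigma (rule : ℕ → Ω → 𝓧 → Bool) (X : ℤ → Ω → 𝓧) (t : ℕ) : MeasurableSpace Ω :=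
  MeasurableSpace.comap (fun ω (i : Fin t) => decision rule X i ω) MeasurableSpace.pi

/-- The selection rule is decision-driven: for every `t` the random function `Π_t` is
`σ(S_0, …, S_{t-1})`-measurable, where `𝓧 → {0, 1}` carries the `σ`-field generated by the
evaluations at the points of `𝓧`. -/
def IsDecisionDriven (rule : ℕ → Ω → 𝓧 → Bool) (X : ℤ → Ω → 𝓧) : Prop :=
  ∀ t : ℕ, Measurable[decisionSigma rule X t] (rule t)

/-- The online times `0 ≤ i ≤ t - 1` with `Π_t(X_i) = 1`. -/
def onlinePicked (rule : ℕ → Ω → 𝓧 → Bool) (X : ℤ → Ω → 𝓧) (t : ℕ) (ω : Ω) : Finset ℕ :=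
  {i ∈ Finset.range t | rule t ω (X i ω) = true}

/-- The intersecting adaptive pick rule: `Π_t(x)` times the product, over the online times `i` with
`Π_t(X_i) = 1`, of the indicators of `Π_i(x) = Π_i(X_t)`. It is the same rule for all indices `s`
of the holdout set. -/
def adaptivePick (rule : ℕ → Ω → 𝓧 → Bool) (X : ℤ → Ω → 𝓧) (t : ℕ) (ω : Ω) (x : 𝓧) : Bool :=
  rule t ω x && decide (∀ i ∈ onlinePicked rule X t ω, rule i ω x = rule i ω (X t ω))

/-- The indices `-n ≤ s ≤ t - 1` of the full holdout set that the adaptive rule picks. -/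
def calibrationSet (n : ℕ) (rule : ℕ → Ω → 𝓧 → Bool) (X : ℤ → Ω → 𝓧) (t : ℕ) (ω : Ω) :
    Finset ℤ :=
  {s ∈ Finset.Ico (-(n : ℤ)) (t : ℤ) | adaptivePick rule X t ω (X s ω) = true}

/-- The `k`-th smallest value (`k ≥ 1`, with multiplicities) of the finite family `(R i)_{i ∈ C}`,
that is, the least real `x` such that at least `k` members of the family are `≤ x`;
it is `+∞` when the family has fewer than `k` members. -/
def kthSmallest (k : ℕ) (C : Finset ℤ) (R : ℤ → ℝ) : EReal :=
  sInf {q : EReal | ∃ x : ℝ, q = (x : EReal) ∧ k ≤ (C.filter (fun i => R i ≤ x)).card}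

/-- `q_α`: the `⌈(1 - α)(|C| + 1)⌉`-th smallest value of `(R i)_{i ∈ C}`. -/
def conformalQuantile (α : ℝ) (C : Finset ℤ) (R : ℤ → ℝ) : EReal :=
  kthSmallest ⌈(1 - α) * ((C.card : ℝ) + 1)⌉₊ C R

/-- The absolute residual `R_i = |Y_i - μ(X_i)|`. -/
def residual (μ : 𝓧 → ℝ) (X : ℤ → Ω → 𝓧) (Y : ℤ → Ω → ℝ) (ω : Ω) (i : ℤ) : ℝ :=
  |Y i ω - μ (X i ω)|

/-- The prediction interval `[μ(X_t) - q, μ(X_t) + q]` with `q = q_α((R_i)_{i ∈ C_t})`, where `C_t`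
is the picked calibration set; it is the whole line when `q = +∞`. -/
def capInterval (n : ℕ) (α : ℝ) (μ : 𝓧 → ℝ) (rule : ℕ → Ω → 𝓧 → Bool) (X : ℤ → Ω → 𝓧)
    (Y : ℤ → Ω → ℝ) (t : ℕ) (ω : Ω) : Set ℝ :=
  {y : ℝ |
    (μ (X t ω) : EReal) - conformalQuantile α (calibrationSet n rule X t ω) (residual μ X Y ω)
        ≤ (y : EReal) ∧
      (y : EReal) ≤
        (μ (X t ω) : EReal) +
          conformalQuantile α (calibrationSet n rule X t ω) (residual μ X Y ω)}

open Classical in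
/-- The false coverage proportion up to time `T` of a procedure with decisions `S` and prediction
sets `I` for the labels `Y`. -/
def fcp (S : ℕ → Ω → Bool) (I : ℕ → Ω → Set ℝ) (Y : ℤ → Ω → ℝ) (T : ℕ) (ω : Ω) : ℝ :=
  (∑ t ∈ Finset.range (T + 1), if S t ω = true ∧ Y t ω ∉ I t ω then (1 : ℝ) else 0) /
    max 1 (∑ j ∈ Finset.range (T + 1), if S j ω = true then (1 : ℝ) else 0)

/-- The false coverage rate `FCR(T) = 𝔼[FCP(T)]`. -/
def fcr [MeasurableSpace Ω] (P : Measure Ω) (S : ℕ → Ω → Bool) (I : ℕ → Ω → Set ℝ)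
    (Y : ℤ → Ω → ℝ) (T : ℕ) : ℝ :=
  ∫ ω, fcp S I Y T ω ∂P

end OnlineConformal

end

noncomputable section

namespace OnlineConformal

open ProbabilityTheory

variable {Ω Ω' 𝓧 𝓩 : Type*}

/-! ### The conformal quantile -/

/-! Fix a whole decision path `p` up to `T`. On the event that `p` occurs, decision-driven rules are
fixed functions (`IsDecisionDriven.rule_eq_of_path`), and the event says exactly that these
functions, applied to the data, output `p`. Let `t` be selected on `p`. Swapping the datum at `t`
with a calibration datum `r` changes no decision: rule `t` accepts both, and if `r` is online then
`r` is itself a picked time, so rule `r` agrees on both points (`rule_apply_swap`). The calibration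
set does not change either (`fixedCalibrationSet_swap`).

Hence the event "path `p` and calibration set `D`" is invariant under swaps of `t` with members of
`D`. By exchangeability and a deterministic count, miscoverage has conditional probability at most
`α` there (`measureReal_card_filter_lt_le`), and summing over `D` gives the same given `p` alone
(`IsDecisionDriven.path_miss`). The denominator of the FCP is constant on each path, so averaging
over paths bounds the FCR; averaging over the paths that select at `t` gives conditional coverage.
-/

theorem kthSmallest_lt_coe_iff {k : ℕ} (hk : 0 < k) (C : Finset ℤ) (R : ℤ → ℝ) (r : ℝ) :
    kthSmallest k C R < (r : EReal) ↔ k ≤ (C.filter (fun i => R i < r)).card := by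
  rw [kthSmallest, sInf_lt_iff]
  constructor
  · rintro ⟨_, ⟨x, rfl, hx⟩, hlt⟩
    refine hx.trans (Finset.card_le_card fun i hi => ?_)
    rw [Finset.mem_filter] at hi ⊢
    exact ⟨hi.1, hi.2.trans_lt (EReal.coe_lt_coe_iff.1 hlt)⟩
  · intro h
    obtain ⟨i, hi, hmax⟩ := Finset.exists_max_image (C.filter (fun i => R i < r)) R
      (Finset.card_pos.1 (hk.trans_le h))
    refine ⟨R i, ⟨R i, rfl, h.trans (Finset.card_le_card fun j hj => ?_)⟩,
      EReal.coe_lt_coe_iff.2 (Finset.mem_filter.1 hi).2⟩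
    exact Finset.mem_filter.2 ⟨(Finset.mem_filter.1 hj).1, hmax j hj⟩

theorem mem_symmetric_interval_iff (m y : ℝ) (q : EReal) :
    (m : EReal) - q ≤ y ∧ (y : EReal) ≤ m + q ↔ ((|y - m| : ℝ) : EReal) ≤ q := by
  induction q using EReal.rec with
  | bot => simp
  | coe q =>
    norm_cast
    rw [abs_le]
    constructor <;> rintro ⟨h₁, h₂⟩ <;> constructor <;> linarith
  | top => simp

/-- Reduces miscoverage to a count of strict comparisons between residuals. The case `q = +∞` needs
no separate treatment: the count cannot reach a rank exceeding the size of the calibration set. -/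
theorem notMem_capInterval_iff (n : ℕ) {α : ℝ} (hα : α < 1) (μ : 𝓧 → ℝ)
    (rule : ℕ → Ω → 𝓧 → Bool) (X : ℤ → Ω → 𝓧) (Y : ℤ → Ω → ℝ) (t : ℕ) (ω : Ω) :
    Y t ω ∉ capInterval n α μ rule X Y t ω ↔
      ⌈(1 - α) * (((calibrationSet n rule X t ω).card : ℝ) + 1)⌉₊ ≤
        ((calibrationSet n rule X t ω).filter
          (fun i => residual μ X Y ω i < residual μ X Y ω t)).card := by
  have hk : 0 < ⌈(1 - α) * (((calibrationSet n rule X t ω).card : ℝ) + 1)⌉₊ :=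
    Nat.ceil_pos.2 (mul_pos (sub_pos.2 hα) (by positivity))
  rw [← kthSmallest_lt_coe_iff hk, capInterval, Set.mem_ofPred_eq, mem_symmetric_interval_iff,
    not_le]
  rfl

/-- Among finitely many reals, the proportion of those that strictly exceed at least a fraction
`1 - α` of all of them is at most `α`. -/
theorem card_filter_card_lt_le {ι : Type*} (D : Finset ι) (v : ι → ℝ) {α : ℝ} (hα : 0 ≤ α)
    {k : ℕ} (hk : (1 - α) * (D.card : ℝ) ≤ k) :
    ((D.filter (fun j => k ≤ (D.filter (fun i => v i < v j)).card)).card : ℝ) ≤ α * D.card := by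
  classical
  set M := D.filter (fun j => k ≤ (D.filter (fun i => v i < v j)).card) with hM
  rcases M.eq_empty_or_nonempty with h | h
  · rw [h]
    simp only [Finset.card_empty, Nat.cast_zero]
    positivity
  -- Everything strictly below the smallest member of `M` lies outside `M`, and there are at least
  -- `k` such elements.
  · obtain ⟨j, hj, hmin⟩ := Finset.exists_min_image M v h
    have hsub : D.filter (fun i => v i < v j) ⊆ D \ M := fun i hi =>
      Finset.mem_sdiff.2 ⟨(Finset.mem_filter.1 hi).1,
        fun hiM => (hmin i hiM).not_gt (Finset.mem_filter.1 hi).2⟩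
    have h₁ := (Finset.mem_filter.1 hj).2.trans (Finset.card_le_card hsub)
    have hMD : M ⊆ D := Finset.filter_subset _ _
    have h₂ := Finset.card_sdiff_add_card_eq_card hMD
    have h₃ : k + M.card ≤ D.card := by omega
    have h₄ : (k : ℝ) + M.card ≤ D.card := by exact_mod_cast h₃
    linarith

/-! ### Probabilities split along a finite partition -/

section Fibers

variable {β : Type*} {A M : Set Ω} {F : Finset β} {f : Ω → β}

theorem eq_biUnion_inter_fiber (hF : ∀ ω ∈ A, f ω ∈ F) : A = ⋃ b ∈ F, A ∩ f ⁻¹' {b} := by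
  ext ω
  simp only [Set.mem_iUnion, Set.mem_inter_iff, exists_prop]
  exact ⟨fun h => ⟨f ω, hF ω h, h, rfl⟩, fun ⟨_, _, h, _⟩ => h⟩

theorem measurableSet_of_inter_fiber [MeasurableSpace Ω] (hF : ∀ ω ∈ A, f ω ∈ F)
    (hA : ∀ b ∈ F, MeasurableSet (A ∩ f ⁻¹' {b})) : MeasurableSet A := by
  rw [eq_biUnion_inter_fiber hF]
  exact F.measurableSet_biUnion hA

theorem sum_measureReal_inter_fiber [MeasurableSpace Ω] (P : Measure Ω) [IsFiniteMeasure P]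
    (hF : ∀ ω ∈ A, f ω ∈ F) (hA : ∀ b ∈ F, MeasurableSet (A ∩ f ⁻¹' {b})) :
    ∑ b ∈ F, P.real (A ∩ f ⁻¹' {b}) = P.real A := by
  conv_rhs => rw [eq_biUnion_inter_fiber hF]
  rw [measureReal_biUnion_finset _ hA]
  intro b _ c _ hbc
  refine Set.disjoint_left.2 fun ω hb hc => hbc ?_
  exact hb.2.symm.trans hc.2

/-- Applied both to the partition by calibration set and to the partition by decision path. -/
theorem measureReal_inter_le_of_inter_fiber [MeasurableSpace Ω] (P : Measure Ω)
    [IsFiniteMeasure P] {c : ℝ} (hF : ∀ ω ∈ A, f ω ∈ F)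
    (hA : ∀ b ∈ F, MeasurableSet (A ∩ f ⁻¹' {b}))
    (hM : ∀ b ∈ F, MeasurableSet (A ∩ M ∩ f ⁻¹' {b}))
    (h : ∀ b ∈ F, P.real (A ∩ M ∩ f ⁻¹' {b}) ≤ c * P.real (A ∩ f ⁻¹' {b})) :
    P.real (A ∩ M) ≤ c * P.real A := by
  rw [← sum_measureReal_inter_fiber P hF hA,
    ← sum_measureReal_inter_fiber P (fun ω hω => hF ω hω.1) hM, Finset.mul_sum]
  exact Finset.sum_le_sum h

end Fibers

/-! ### Exchangeability -/

/-- The joint law is the product of the marginals, which are all equal, so permuting the factors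
does nothing. -/
theorem measurePreserving_comp_perm {ι : Type*} [MeasurableSpace Ω] [MeasurableSpace 𝓩]
    {P : Measure Ω} {Z : ι → Ω → 𝓩} (hZ : ∀ i, Measurable (Z i)) (hindep : iIndepFun Z P)
    (hident : ∀ i j, IdentDistrib (Z i) (Z j) P P) (σ : Equiv.Perm ι) :
    MeasurePreserving (fun (z : ι → 𝓩) i => z (σ i)) (P.map fun ω i => Z i ω)
      (P.map fun ω i => Z i ω) := by
  have hm : Measurable fun ω i => Z i ω := measurable_pi_iff.2 hZ
  refine ⟨measurable_pi_iff.2 fun i => measurable_pi_apply _, ?_⟩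
  rw [Measure.map_map (measurable_pi_iff.2 fun i => measurable_pi_apply _) hm]
  have h := (hindep.precomp σ.injective).map_fun_eq_infinitePi_map fun i => hZ (σ i)
  rw [hindep.map_fun_eq_infinitePi_map hZ]
  refine h.trans ?_
  congr 1
  funext i
  exact (hident (σ i) i).map_eq

/-- A family indexed by the integers `≥ m`, extended by a constant to all integers. -/
def extendConst (m : ℤ) (c : 𝓩) (z : ℤ → 𝓩) (i : ℤ) : 𝓩 :=
  if m ≤ i then z i else c

theorem measurePreserving_extendConst_swap [MeasurableSpace Ω] [MeasurableSpace 𝓩]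
    {P : Measure Ω} {m : ℤ} {Z : ℤ → Ω → 𝓩} (hZ : ∀ i, m ≤ i → Measurable (Z i))
    (hindep : iIndepFun (fun (i : Set.Ici m) => Z i) P)
    (hident : ∀ i j, m ≤ i → m ≤ j → IdentDistrib (Z i) (Z j) P P) (c : 𝓩) {s t : ℤ}
    (hs : m ≤ s) (ht : m ≤ t) :
    MeasurePreserving (fun (z : ℤ → 𝓩) i => z (Equiv.swap s t i))
      (P.map fun ω => extendConst m c fun i => Z i ω)
      (P.map fun ω => extendConst m c fun i => Z i ω) := by
  let e : (Set.Ici m → 𝓩) → ℤ → 𝓩 := fun z i => if h : m ≤ i then z ⟨i, h⟩ else c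
  have he : Measurable e := by
    refine measurable_pi_iff.2 fun i => ?_
    by_cases h : m ≤ i
    · simpa [e, h] using measurable_pi_apply _
    · simp [e, h]
  have hm : Measurable fun ω (i : Set.Ici m) => Z i ω := measurable_pi_iff.2 fun i => hZ i i.2
  have hP : (P.map fun ω => extendConst m c fun i => Z i ω)
      = (P.map fun ω (i : Set.Ici m) => Z i ω).map e := by
    rw [Measure.map_map he hm]
    congr 1
  have hσ : Measurable fun (z : ℤ → 𝓩) i => z (Equiv.swap s t i) :=
    measurable_pi_iff.2 fun i => measurable_pi_apply _
  have h := measurePreserving_comp_perm (fun i : Set.Ici m => hZ i i.2) hindep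
    (fun i j => hident i j i.2 j.2) (Equiv.swap ⟨s, hs⟩ ⟨t, ht⟩)
  refine ⟨hσ, ?_⟩
  rw [hP, Measure.map_map hσ he]
  -- The embedding `e` intertwines the swap on `Set.Ici m` with the swap on `ℤ`.
  conv_rhs => rw [← h.map_eq, Measure.map_map he h.measurable]
  congr 1
  funext z i
  simp only [e, Function.comp_apply]
  by_cases his : i = s
  · subst his; simp [hs, ht]
  by_cases hit : i = t
  · subst hit; simp [hs, ht]
  rw [Equiv.swap_apply_of_ne_of_ne his hit]
  by_cases hi : m ≤ i
  · rw [dif_pos hi, dif_pos hi, Equiv.swap_apply_of_ne_of_ne (fun h => his (congrArg Subtype.val h))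
      fun h => hit (congrArg Subtype.val h)]
  · rw [dif_neg hi, dif_neg hi]

theorem measurableSet_card_filter_lt {ι : Type*} [MeasurableSpace 𝓩] {R : 𝓩 → ℝ}
    (hR : Measurable R) (D : Finset ι) (k : ℕ) (j : ι) :
    MeasurableSet {z : ι → 𝓩 | k ≤ (D.filter fun i => R (z i) < R (z j)).card} := by
  have : Measurable fun z : ι → 𝓩 => (D.filter fun i => R (z i) < R (z j)).card := by
    simp only [Finset.card_filter]
    refine Finset.measurable_sum _ fun i _ => Measurable.ite ?_ measurable_const measurable_const
    exact measurableSet_lt (hR.comp (measurable_pi_apply i)) (hR.comp (measurable_pi_apply j))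
  exact this measurableSet_Ici

/-- If an event is invariant under the transpositions of `t` with the members of `D`, then on it
the score of `t` is too large, compared with the scores in `D`, with conditional probability at
most `α`. -/
theorem measureReal_card_filter_lt_le {ι : Type*} [DecidableEq ι] [MeasurableSpace 𝓩]
    {ν : Measure (ι → 𝓩)} [IsFiniteMeasure ν] {R : 𝓩 → ℝ} (hR : Measurable R) {α : ℝ}
    (hα : 0 ≤ α) {D : Finset ι} {t : ι} (ht : t ∉ D) {B : Set (ι → 𝓩)} (hB : MeasurableSet B)
    (hν : ∀ s ∈ D, MeasurePreserving (fun z i => z (Equiv.swap s t i)) ν ν)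
    (hswap : ∀ s ∈ D, ∀ z ∈ B, (fun i => z (Equiv.swap s t i)) ∈ B) {k : ℕ}
    (hk : (1 - α) * ((D.card : ℝ) + 1) ≤ k) :
    ν.real (B ∩ {z | k ≤ (D.filter fun i => R (z i) < R (z t)).card}) ≤ α * ν.real B := by
  let E : ι → Set (ι → 𝓩) :=
    fun j => {z | k ≤ ((insert t D).filter fun i => R (z i) < R (z j)).card}
  have hE : ∀ j, MeasurableSet (E j) := fun j => measurableSet_card_filter_lt hR _ k j
  -- Comparison is strict, so `t` never counts against itself.
  have hEt : {z | k ≤ (D.filter fun i => R (z i) < R (z t)).card} = E t := by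
    ext z
    simp [E, Finset.filter_insert]
  have hcard : ((insert t D).card : ℝ) = (D.card : ℝ) + 1 := by
    rw [Finset.card_insert_of_notMem ht]; push_cast; rfl
  have hinv : ∀ s ∈ D, ∀ z, (fun i => z (Equiv.swap s t i)) ∈ B ↔ z ∈ B := fun s hs z =>
    ⟨fun h => by simpa using hswap s hs _ h, hswap s hs z⟩
  -- The swap of `j` and `t` preserves `ν`, `B` and `insert t D`, and pulls `E t` back to `E j`.
  have hsame : ∀ j ∈ insert t D, ν.real (B ∩ E j) = ν.real (B ∩ E t) := by
    intro j hj
    rcases Finset.mem_insert.1 hj with rfl | hjD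
    · rfl
    rw [← (hν j hjD).measureReal_preimage (hB.inter (hE t)).nullMeasurableSet]
    congr 1
    ext z
    refine and_congr (hinv j hjD z).symm ?_
    have hmem : ∀ i, Equiv.swap j t i ∈ insert t D ↔ i ∈ insert t D := by
      intro i
      by_cases h₁ : i = j
      · subst h₁; simp [hjD]
      by_cases h₂ : i = t
      · subst h₂; simp [hjD]
      rw [Equiv.swap_apply_of_ne_of_ne h₁ h₂]
    have : ((insert t D).filter fun i => R (z i) < R (z j)).card
        = ((insert t D).filter fun i =>
            R (z (Equiv.swap j t i)) < R (z (Equiv.swap j t t))).card := by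
      refine Finset.card_equiv (Equiv.swap j t) fun i => ?_
      simp [-Finset.mem_insert, hmem]
    simp only [E, Set.mem_ofPred_eq, this]
  -- The pointwise count `card_filter_card_lt_le`, integrated over `B`.
  have hsum : ∑ j ∈ insert t D, ν.real (B ∩ E j) ≤ (α * ((D.card : ℝ) + 1)) * ν.real B := by
    have h₁ : ∀ j, ν.real (B ∩ E j) = ∫ z in B, (E j).indicator (fun _ => (1 : ℝ)) z ∂ν := by
      intro j
      rw [integral_indicator_const _ (hE j), measureReal_restrict_apply (hE j), Set.inter_comm]
      simp
    have hint : ∀ j ∈ insert t D,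
        Integrable ((E j).indicator fun _ => (1 : ℝ)) (ν.restrict B) :=
      fun j _ => (integrable_const _).indicator (hE j)
    simp_rw [h₁]
    rw [← integral_finsetSum _ hint]
    calc ∫ z in B, ∑ j ∈ insert t D, (E j).indicator (fun _ => (1 : ℝ)) z ∂ν
        ≤ ∫ _ in B, α * ((D.card : ℝ) + 1) ∂ν := by
          refine integral_mono (integrable_finsetSum _ hint) (integrable_const _) fun z => ?_
          have := card_filter_card_lt_le (insert t D) (fun i => R (z i)) hα (k := k)
            (by rwa [hcard])
          rw [hcard] at this
          refine le_trans (le_of_eq ?_) this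
          rw [Finset.card_filter]
          push_cast
          exact Finset.sum_congr rfl fun j _ => by simp [Set.indicator_apply, E]
      _ = (α * ((D.card : ℝ) + 1)) * ν.real B := by simp [mul_comm]
  rw [Finset.sum_congr rfl hsame, Finset.sum_const, nsmul_eq_mul, hcard] at hsum
  rw [hEt]
  have hpos : (0 : ℝ) < (D.card : ℝ) + 1 := by positivity
  refine le_of_mul_le_mul_left ?_ hpos
  linarith

/-! ### The calibration set of the intersecting pick rule -/

theorem adaptivePick_eq_true_iff (rule : ℕ → Ω → 𝓧 → Bool) (X : ℤ → Ω → 𝓧) (t : ℕ) (ω : Ω)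
    (x : 𝓧) : adaptivePick rule X t ω x = true ↔ rule t ω x = true ∧
      ∀ i < t, rule t ω (X i ω) = true → rule i ω x = rule i ω (X t ω) := by
  simp [adaptivePick, onlinePicked]

theorem mem_calibrationSet_iff (n : ℕ) (rule : ℕ → Ω → 𝓧 → Bool) (X : ℤ → Ω → 𝓧) (t : ℕ) (ω : Ω)
    (j : ℤ) : j ∈ calibrationSet n rule X t ω ↔ (-(n : ℤ) ≤ j ∧ j < t) ∧
      rule t ω (X j ω) = true ∧
      ∀ i < t, rule t ω (X i ω) = true → rule i ω (X j ω) = rule i ω (X t ω) := by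
  rw [calibrationSet, Finset.mem_filter, Finset.mem_Ico, adaptivePick_eq_true_iff]

/-- The calibration set at time `t` depends only on the rules up to time `t` and on the data with
indices from `-n` on. -/
theorem calibrationSet_congr {n : ℕ} {rule : ℕ → Ω → 𝓧 → Bool} {rule' : ℕ → Ω' → 𝓧 → Bool}
    {X : ℤ → Ω → 𝓧} {X' : ℤ → Ω' → 𝓧} {t : ℕ} {ω : Ω} {ω' : Ω'}
    (hrule : ∀ i ≤ t, rule i ω = rule' i ω') (hX : ∀ i : ℤ, -(n : ℤ) ≤ i → X i ω = X' i ω') :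
    calibrationSet n rule X t ω = calibrationSet n rule' X' t ω' := by
  have hX' : ∀ i : ℕ, X i ω = X' i ω' := fun i => hX i (by omega)
  ext j
  rw [mem_calibrationSet_iff, mem_calibrationSet_iff]
  refine and_congr_right fun hj => ?_
  rw [hrule t le_rfl, hX j hj.1, hX' t]
  refine and_congr_right fun _ => forall₂_congr fun i hi => ?_
  rw [hrule i hi.le, hX' i]

/-- Transfers miscoverage from `Ω` with random rules to the sequence space with frozen rules. -/
theorem notMem_capInterval_congr {n : ℕ} {α : ℝ} (hα : α < 1) (μ : 𝓧 → ℝ)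
    {rule : ℕ → Ω → 𝓧 → Bool} {rule' : ℕ → Ω' → 𝓧 → Bool} {X : ℤ → Ω → 𝓧} {X' : ℤ → Ω' → 𝓧}
    {Y : ℤ → Ω → ℝ} {Y' : ℤ → Ω' → ℝ} {t : ℕ} {ω : Ω} {ω' : Ω'}
    (hrule : ∀ i ≤ t, rule i ω = rule' i ω') (hX : ∀ i : ℤ, -(n : ℤ) ≤ i → X i ω = X' i ω')
    (hY : ∀ i : ℤ, -(n : ℤ) ≤ i → Y i ω = Y' i ω') :
    Y t ω ∉ capInterval n α μ rule X Y t ω ↔ Y' t ω' ∉ capInterval n α μ rule' X' Y' t ω' := by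
  have hR : ∀ i : ℤ, -(n : ℤ) ≤ i → residual μ X Y ω i = residual μ X' Y' ω' i := fun i hi => by
    rw [residual, residual, hX i hi, hY i hi]
  rw [notMem_capInterval_iff n hα, notMem_capInterval_iff n hα, calibrationSet_congr hrule hX,
    hR t (by omega)]
  rw [Finset.filter_congr fun i hi => by rw [hR i ((mem_calibrationSet_iff ..).1 hi).1.1]]

/-! ### Fixed rules -/

section FixedRule

variable (n : ℕ) (rule : ℕ → 𝓧 → Bool) (t : ℕ)

/-- The calibration set for non-random rules, as a function of the data. -/
def fixedCalibrationSet (z : ℤ → 𝓧 × ℝ) : Finset ℤ :=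
  calibrationSet n (fun i _ => rule i) (fun i (z : ℤ → 𝓧 × ℝ) => (z i).1) t z

variable {n rule t}

theorem apply_swap_eq {β : Type*} {r t : ℤ} {u : ℤ → β} (h : u r = u t) (j : ℤ) :
    u (Equiv.swap r t j) = u j := by
  by_cases h₁ : j = r
  · subst h₁; simp [h]
  by_cases h₂ : j = t
  · subst h₂; simp [h]
  rw [Equiv.swap_apply_of_ne_of_ne h₁ h₂]

/-- Exchanging the datum at a selected time `t` with one of its calibration data changes none of
the decisions. -/
theorem rule_apply_swap {z : ℤ → 𝓧 × ℝ} (ht : rule t (z t).1 = true) {r : ℤ}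
    (hr : r ∈ fixedCalibrationSet n rule t z) (i : ℕ) :
    rule i (z (Equiv.swap r t i)).1 = rule i (z i).1 := by
  obtain ⟨⟨-, hrt⟩, hr₁, hr₂⟩ := (mem_calibrationSet_iff ..).1 hr
  by_cases h₁ : (i : ℤ) = r
  · subst h₁
    rw [Equiv.swap_apply_left]
    -- Rule `t` accepts `r`, so `r` is one of the times over which the pick rule intersects; its own
    -- constraint is the one needed.
    exact (hr₂ i (by omega) hr₁).symm
  by_cases h₂ : (i : ℤ) = t
  · obtain rfl : i = t := by omega
    rw [Equiv.swap_apply_right, ht]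
    exact hr₁
  rw [Equiv.swap_apply_of_ne_of_ne h₁ h₂]

/-- Exchanging the datum at a selected time `t` with one of its calibration data does not change
the calibration set. -/
theorem fixedCalibrationSet_swap {z : ℤ → 𝓧 × ℝ} (ht : rule t (z t).1 = true) {r : ℤ}
    (hr : r ∈ fixedCalibrationSet n rule t z) :
    fixedCalibrationSet n rule t (fun i => z (Equiv.swap r t i))
      = fixedCalibrationSet n rule t z := by
  obtain ⟨-, hr₁, hr₂⟩ := (mem_calibrationSet_iff ..).1 hr
  have h : ∀ j : ℤ, rule t (z (Equiv.swap r t j)).1 = rule t (z j).1 :=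
    apply_swap_eq (u := fun j => rule t (z j).1) (hr₁.trans ht.symm)
  ext j
  rw [fixedCalibrationSet, mem_calibrationSet_iff, fixedCalibrationSet, mem_calibrationSet_iff]
  refine and_congr_right fun _ => ?_
  simp only [h]
  refine and_congr_right fun _ => forall₃_congr fun i hi hi' => ?_
  have h' : ∀ j : ℤ, rule i (z (Equiv.swap r t j)).1 = rule i (z j).1 :=
    apply_swap_eq (u := fun j => rule i (z j).1) (hr₂ i hi hi')
  rw [h', h']

variable [MeasurableSpace 𝓧]

theorem measurableSet_fixedCalibrationSet_eq (hrule : ∀ i ≤ t, Measurable (rule i))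
    (D : Finset ℤ) : MeasurableSet (fixedCalibrationSet n rule t ⁻¹' {D}) := by
  have hm : ∀ i ≤ t, ∀ j : ℤ, Measurable fun z : ℤ → 𝓧 × ℝ => rule i (z j).1 := fun i hi j =>
    (hrule i hi).comp (measurable_fst.comp (measurable_pi_apply j))
  have hpick : ∀ j : ℤ, MeasurableSet {z : ℤ → 𝓧 × ℝ | j ∈ fixedCalibrationSet n rule t z} := by
    intro j
    simp only [fixedCalibrationSet, mem_calibrationSet_iff]
    refine .inter (.const _) (.inter (hm t le_rfl j (measurableSet_singleton true)) ?_)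
    change MeasurableSet {z : ℤ → 𝓧 × ℝ | ∀ i < t, rule t (z i).1 = true →
      rule i (z j).1 = rule i (z t).1}
    simp only [Set.ofPred_forall]
    exact .iInter fun i => .iInter fun hi => MeasurableSet.imp
      (hm t le_rfl i (measurableSet_singleton true))
      (measurableSet_eq_fun (hm i hi.le j) (hm i hi.le t))
  have : fixedCalibrationSet n rule t ⁻¹' {D}
      = ⋂ j : ℤ, {z | j ∈ fixedCalibrationSet n rule t z ↔ j ∈ D} := by
    ext z
    simp [Finset.ext_iff]
  rw [this]
  exact .iInter fun j => (hpick j).iff (.const _)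

theorem measurableSet_fixed_path {T : ℕ} (hrule : ∀ i ≤ T, Measurable (rule i))
    (p : Fin (T + 1) → Bool) :
    MeasurableSet {z : ℤ → 𝓧 × ℝ | ∀ i : Fin (T + 1), rule i (z (i : ℕ)).1 = p i} := by
  simp only [Set.ofPred_forall]
  exact .iInter fun i => ((hrule i (by omega)).comp
    (measurable_fst.comp (measurable_pi_apply _))) (measurableSet_singleton (p i))

/-- Miscoverage at time `t` for non-random rules. -/
def fixedMiss (n : ℕ) (α : ℝ) (μ : 𝓧 → ℝ) (rule : ℕ → 𝓧 → Bool) (t : ℕ) : Set (ℤ → 𝓧 × ℝ) :=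
  {z | (z t).2 ∉ capInterval n α μ (fun i _ => rule i) (fun i (z : ℤ → 𝓧 × ℝ) => (z i).1)
    (fun i z => (z i).2) t z}

/-- The path event is cut by the value `D` of the calibration set, and each cell is swap-invariant.
The path may extend beyond `t`, as the FCP denominator at `T` requires. -/
theorem fixed_path_miss {α : ℝ} (hα0 : 0 ≤ α) (hα1 : α < 1) {μ : 𝓧 → ℝ} (hμ : Measurable μ)
    {ν : Measure (ℤ → 𝓧 × ℝ)} [IsFiniteMeasure ν]
    (hν : ∀ s t : ℤ, -(n : ℤ) ≤ s → -(n : ℤ) ≤ t →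
      MeasurePreserving (fun z i => z (Equiv.swap s t i)) ν ν)
    {T : ℕ} (hrule : ∀ i ≤ T, Measurable (rule i)) {p : Fin (T + 1) → Bool} {t : Fin (T + 1)}
    (hp : p t = true) :
    MeasurableSet ({z : ℤ → 𝓧 × ℝ | ∀ i : Fin (T + 1), rule i (z (i : ℕ)).1 = p i}
      ∩ fixedMiss n α μ rule t) ∧
    ν.real ({z : ℤ → 𝓧 × ℝ | ∀ i : Fin (T + 1), rule i (z (i : ℕ)).1 = p i}
      ∩ fixedMiss n α μ rule t) ≤
      α * ν.real {z : ℤ → 𝓧 × ℝ | ∀ i : Fin (T + 1), rule i (z (i : ℕ)).1 = p i} := by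
  set B := {z : ℤ → 𝓧 × ℝ | ∀ i : Fin (T + 1), rule i (z (i : ℕ)).1 = p i} with hBdef
  have htT : (t : ℕ) ≤ T := by omega
  have hR : Measurable fun q : 𝓧 × ℝ => |q.2 - μ q.1| :=
    (measurable_snd.sub (hμ.comp measurable_fst)).abs
  let f := fixedCalibrationSet n rule t
  have hF : ∀ z ∈ B, f z ∈ (Finset.Ico (-(n : ℤ)) (t : ℕ)).powerset := fun z _ =>
    Finset.mem_powerset.2 (Finset.filter_subset _ _)
  have hA : ∀ D, MeasurableSet (B ∩ f ⁻¹' {D}) := fun D =>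
    (measurableSet_fixed_path hrule p).inter
      (measurableSet_fixedCalibrationSet_eq (fun i hi => hrule i (hi.trans htT)) D)
  have hfib : ∀ D, B ∩ fixedMiss n α μ rule t ∩ f ⁻¹' {D} = (B ∩ f ⁻¹' {D}) ∩
      {z | ⌈(1 - α) * ((D.card : ℝ) + 1)⌉₊ ≤ (D.filter fun i =>
        |(z i).2 - μ (z i).1| < |(z (t : ℕ)).2 - μ (z (t : ℕ)).1|).card} := by
    intro D
    rw [Set.inter_right_comm]
    ext z
    refine and_congr_right fun hz => ?_
    have hz : calibrationSet n (fun i _ => rule i) (fun i (z : ℤ → 𝓧 × ℝ) => (z i).1) t z = D :=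
      hz.2
    have := notMem_capInterval_iff n hα1 μ (fun i _ => rule i)
      (fun i (z : ℤ → 𝓧 × ℝ) => (z i).1) (fun i z => (z i).2) t z
    rw [hz] at this
    exact this
  have hAM : ∀ D, MeasurableSet (B ∩ fixedMiss n α μ rule t ∩ f ⁻¹' {D}) := fun D => by
    rw [hfib]
    exact (hA D).inter (measurableSet_card_filter_lt hR D _ _)
  refine ⟨measurableSet_of_inter_fiber (fun z hz => hF z hz.1) fun D _ => hAM D,
    measureReal_inter_le_of_inter_fiber ν hF (fun D _ => hA D) (fun D _ => hAM D) ?_⟩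
  intro D hD
  have hD : ∀ s ∈ D, -(n : ℤ) ≤ s ∧ s < (t : ℕ) := fun s hs =>
    Finset.mem_Ico.1 (Finset.mem_powerset.1 hD hs)
  rw [hfib]
  refine measureReal_card_filter_lt_le hR hα0 (fun h => (hD _ h).2.false) (hA D)
    (fun s hs => hν s _ (hD s hs).1 (by omega)) (fun s hs z hz => ?_) (Nat.le_ceil _)
  have hsel : rule t (z (t : ℕ)).1 = true := (hz.1 t).trans hp
  have hs' : s ∈ fixedCalibrationSet n rule t z := by
    have : fixedCalibrationSet n rule t z = D := hz.2
    rwa [this]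
  exact ⟨fun i => (rule_apply_swap hsel hs' i).trans (hz.1 i),
    (fixedCalibrationSet_swap hsel hs').trans hz.2⟩

end FixedRule

/-! ### Decision-driven rules -/

/-- The decisions up to time `T`. -/
def decisionPath (rule : ℕ → Ω → 𝓧 → Bool) (X : ℤ → Ω → 𝓧) (T : ℕ) (ω : Ω) : Fin (T + 1) → Bool :=
  fun i => decision rule X i ω

/-- For each `x`, a level set of `rule t · x` is the preimage of a set of decision strings, so it
contains both or neither of two outcomes with equal strings. -/
theorem IsDecisionDriven.rule_eq {rule : ℕ → Ω → 𝓧 → Bool} {X : ℤ → Ω → 𝓧}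
    (h : IsDecisionDriven rule X) {t : ℕ} {ω ω' : Ω}
    (hω : ∀ i < t, decision rule X i ω = decision rule X i ω') : rule t ω = rule t ω' := by
  funext x
  have hx : Measurable[decisionSigma rule X t] fun ω => rule t ω x :=
    (measurable_pi_apply x).comp (h t)
  obtain ⟨U, -, hU⟩ := hx (measurableSet_singleton (rule t ω' x))
  have hpath : (fun i : Fin t => decision rule X i ω) = fun i : Fin t => decision rule X i ω' :=
    funext fun i => hω i i.2
  have h' : ω' ∈ (fun ω => rule t ω x) ⁻¹' {rule t ω' x} := rfl
  rw [← hU, Set.mem_preimage, ← hpath, ← Set.mem_preimage (f := fun ω (i : Fin t) =>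
    decision rule X i ω), hU] at h'
  exact h'

/-- On the event that the decisions follow a given path, a decision-driven rule is not random. -/
theorem IsDecisionDriven.rule_eq_of_path {rule : ℕ → Ω → 𝓧 → Bool} {X : ℤ → Ω → 𝓧}
    (h : IsDecisionDriven rule X) {T : ℕ} {ω ω' : Ω}
    (hω : decisionPath rule X T ω = decisionPath rule X T ω') {i : ℕ} (hi : i ≤ T) :
    rule i ω = rule i ω' :=
  h.rule_eq fun j hj => congrFun hω ⟨j, by omega⟩

/-- Expresses the path event through the rules frozen at `ω₀`. The converse is an induction on time:
agreement of earlier decisions fixes the next rule. -/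
theorem IsDecisionDriven.decisionPath_eq_iff {rule : ℕ → Ω → 𝓧 → Bool} {X : ℤ → Ω → 𝓧}
    (h : IsDecisionDriven rule X) {T : ℕ} {ω ω₀ : Ω} :
    decisionPath rule X T ω = decisionPath rule X T ω₀ ↔
      ∀ i : Fin (T + 1), rule i ω₀ (X (i : ℕ) ω) = decisionPath rule X T ω₀ i := by
  constructor
  · intro hω i
    rw [← hω, ← h.rule_eq_of_path hω (by omega : (i : ℕ) ≤ T)]
    rfl
  · intro hω
    have key : ∀ i : ℕ, i ≤ T → decision rule X i ω = decision rule X i ω₀ := by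
      intro i
      induction i using Nat.strong_induction_on with
      | _ i ih =>
        intro hi
        rw [decision, h.rule_eq (ω' := ω₀) fun j hj => ih j hj (by omega)]
        exact hω ⟨i, by omega⟩
    exact funext fun i => key i (by omega)

/-- Given any decision path that selects at time `t`, the conditional probability of miscoverage at
time `t` is at most `α`. A decision-driven rule is a function of the online data alone, so that its
independence of the initial data need not be assumed. -/
theorem IsDecisionDriven.path_miss [MeasurableSpace Ω] [MeasurableSpace 𝓧] {P : Measure Ω}
    [IsFiniteMeasure P] {n : ℕ} {α : ℝ} (hα0 : 0 ≤ α) (hα1 : α < 1) {μ : 𝓧 → ℝ}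
    (hμ : Measurable μ) {X : ℤ → Ω → 𝓧} {Y : ℤ → Ω → ℝ}
    (hX : ∀ i : ℤ, -(n : ℤ) ≤ i → Measurable (X i))
    (hY : ∀ i : ℤ, -(n : ℤ) ≤ i → Measurable (Y i))
    (hindep : iIndepFun (fun (i : Set.Ici (-(n : ℤ))) (ω : Ω) => (X i ω, Y i ω)) P)
    (hident : ∀ i j : ℤ, -(n : ℤ) ≤ i → -(n : ℤ) ≤ j →
      IdentDistrib (fun ω => (X i ω, Y i ω)) (fun ω => (X j ω, Y j ω)) P P)
    {rule : ℕ → Ω → 𝓧 → Bool} (hrule : ∀ t ω, Measurable (rule t ω))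
    (h : IsDecisionDriven rule X) (T : ℕ) (p : Fin (T + 1) → Bool) :
    MeasurableSet (decisionPath rule X T ⁻¹' {p}) ∧ ∀ t : Fin (T + 1), p t = true →
      MeasurableSet (decisionPath rule X T ⁻¹' {p} ∩
        {ω | Y (t : ℕ) ω ∉ capInterval n α μ rule X Y t ω}) ∧
      P.real (decisionPath rule X T ⁻¹' {p} ∩
        {ω | Y (t : ℕ) ω ∉ capInterval n α μ rule X Y t ω}) ≤
        α * P.real (decisionPath rule X T ⁻¹' {p}) := by
  rcases (decisionPath rule X T ⁻¹' {p}).eq_empty_or_nonempty with he | ⟨ω₀, rfl⟩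
  · simp [he]
  -- Nothing is assumed of the data below `-n`, so they are replaced by a constant, here the datum
  -- at time 0 under `ω₀`.
  let W : Ω → ℤ → 𝓧 × ℝ := fun ω =>
    extendConst (-(n : ℤ)) (X 0 ω₀, Y 0 ω₀) fun i => (X i ω, Y i ω)
  have hWi : ∀ ω (i : ℤ), -(n : ℤ) ≤ i → W ω i = (X i ω, Y i ω) := fun ω i hi => if_pos hi
  have hW : Measurable W := by
    refine measurable_pi_iff.2 fun i => ?_
    by_cases hi : -(n : ℤ) ≤ i
    · simpa only [hWi _ i hi] using (hX i hi).prodMk (hY i hi)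
    · simp [W, extendConst, hi]
  have hν : ∀ s t : ℤ, -(n : ℤ) ≤ s → -(n : ℤ) ≤ t →
      MeasurePreserving (fun z i => z (Equiv.swap s t i)) (P.map W) (P.map W) :=
    fun s t hs ht => measurePreserving_extendConst_swap (Z := fun i ω => (X i ω, Y i ω))
      (fun i hi => (hX i hi).prodMk (hY i hi)) hindep hident _ hs ht
  set p := decisionPath rule X T ω₀ with hpdef
  have hr : ∀ i ≤ T, Measurable (rule i ω₀) := fun i _ => hrule i ω₀
  have hB := measurableSet_fixed_path (rule := fun i => rule i ω₀) hr p
  have hpath : decisionPath rule X T ⁻¹' {p} =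
      W ⁻¹' {z | ∀ i : Fin (T + 1), rule i ω₀ (z (i : ℕ)).1 = p i} := by
    ext ω
    refine h.decisionPath_eq_iff.trans (forall_congr' fun i => ?_)
    rw [hWi ω _ (by omega)]
  refine ⟨hpath ▸ hW hB, fun t ht => ?_⟩
  have hmiss : decisionPath rule X T ⁻¹' {p} ∩
        {ω | Y (t : ℕ) ω ∉ capInterval n α μ rule X Y t ω} =
      W ⁻¹' ({z | ∀ i : Fin (T + 1), rule i ω₀ (z (i : ℕ)).1 = p i} ∩
        fixedMiss n α μ (fun i => rule i ω₀) t) := by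
    rw [Set.preimage_inter, ← hpath]
    ext ω
    refine and_congr_right fun hω => ?_
    exact notMem_capInterval_congr hα1 μ
      (fun i hi => h.rule_eq_of_path hω (by omega)) (fun i hi => by rw [hWi ω i hi])
      (fun i hi => by rw [hWi ω i hi])
  obtain ⟨hm, hle⟩ := fixed_path_miss hα0 hα1 hμ hν (rule := fun i => rule i ω₀) hr ht
  rw [hmiss, hpath]
  refine ⟨hW hm, ?_⟩
  rwa [map_measureReal_apply hW hm, map_measureReal_apply hW hB] at hle

/-- Each path fixes the denominator, so the FCP is a finite combination of indicators. -/
theorem fcp_eq_sum_path (rule : ℕ → Ω → 𝓧 → Bool) (X : ℤ → Ω → 𝓧) (I : ℕ → Ω → Set ℝ)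
    (Y : ℤ → Ω → ℝ) (T : ℕ) (ω : Ω) :
    fcp (decision rule X) I Y T ω = ∑ p : Fin (T + 1) → Bool, ∑ t : Fin (T + 1),
      if p t = true then
        (decisionPath rule X T ⁻¹' {p} ∩ {ω | Y (t : ℕ) ω ∉ I t ω}).indicator
          (fun _ => (max 1 (∑ j, if p j = true then (1 : ℝ) else 0))⁻¹) ω
      else 0 := by
  classical
  rw [Finset.sum_eq_single (decisionPath rule X T ω)]
  · rw [fcp, Finset.sum_range, Finset.sum_range, Finset.sum_div]
    refine Finset.sum_congr rfl fun t _ => ?_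
    by_cases h₁ : decision rule X t ω = true
    · by_cases h₂ : Y (t : ℕ) ω ∈ I t ω
      · simp [decisionPath, h₁, h₂]
      · have hω : ω ∈ decisionPath rule X T ⁻¹' {decisionPath rule X T ω} ∩
            {ω | Y (t : ℕ) ω ∉ I t ω} := ⟨rfl, h₂⟩
        rw [Set.indicator_of_mem hω]
        simp only [decisionPath, h₁, h₂, not_false_eq_true, and_self, if_true, one_div]
        congr!
    · simp [decisionPath, h₁]
  · intro p _ hp
    refine Finset.sum_eq_zero fun t _ => ?_
    rw [Set.indicator_of_notMem fun h => hp h.1.symm, ite_self]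
  · simp

end OnlineConformal

end

/-! ### False coverage rate and selection-conditional coverage -/

open ProbabilityTheory OnlineConformal in
theorem mainTheorem1
    {Ω : Type*} [MeasurableSpace Ω] (P : Measure Ω) [IsProbabilityMeasure P]
    (d n : ℕ) (α : ℝ) (hα0 : 0 < α) (hα1 : α < 1)
    (μ : EuclideanSpace ℝ (Fin d) → ℝ) (hμ : Measurable μ)
    (X : ℤ → Ω → EuclideanSpace ℝ (Fin d)) (Y : ℤ → Ω → ℝ)
    (hX : ∀ i : ℤ, -(n : ℤ) ≤ i → Measurable (X i))
    (hY : ∀ i : ℤ, -(n : ℤ) ≤ i → Measurable (Y i))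
    (hindep : ProbabilityTheory.iIndepFun
      (fun (i : Set.Ici (-(n : ℤ))) (ω : Ω) => (X i ω, Y i ω)) P)
    (hident : ∀ i j : ℤ, -(n : ℤ) ≤ i → -(n : ℤ) ≤ j →
      ProbabilityTheory.IdentDistrib (fun ω => (X i ω, Y i ω)) (fun ω => (X j ω, Y j ω)) P P)
    (rule : ℕ → Ω → EuclideanSpace ℝ (Fin d) → Bool)
    (hrule : ∀ (t : ℕ) (ω : Ω), Measurable (rule t ω))
    (hdriven : OnlineConformal.IsDecisionDriven rule X)
    (hinit : ProbabilityTheory.IndepFun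
      (fun (ω : Ω) (t : ℕ) (x : EuclideanSpace ℝ (Fin d)) => rule t ω x)
      (fun (ω : Ω) (i : Set.Ico (-(n : ℤ)) 0) => (X i ω, Y i ω)) P) :
    (∀ T : ℕ,
      Integrable (OnlineConformal.fcp (OnlineConformal.decision rule X)
        (OnlineConformal.capInterval n α μ rule X Y) Y T) P ∧
      OnlineConformal.fcr P (OnlineConformal.decision rule X)
        (OnlineConformal.capInterval n α μ rule X Y) Y T ≤ α) ∧
    (∀ t : ℕ, 0 < P {ω | OnlineConformal.decision rule X t ω = true} →
      1 - α ≤ (ProbabilityTheory.cond P {ω | OnlineConformal.decision rule X t ω = true}).real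
        {ω | Y t ω ∈ OnlineConformal.capInterval n α μ rule X Y t ω}) := by
  have key := hdriven.path_miss hα0.le hα1 hμ hX hY hindep hident hrule
  refine ⟨fun T => ?_, fun t hpos => ?_⟩
  · let A : (Fin (T + 1) → Bool) → Set Ω := fun p => decisionPath rule X T ⁻¹' {p}
    let M : Fin (T + 1) → Set Ω :=
      fun t => {ω | Y (t : ℕ) ω ∉ capInterval n α μ rule X Y t ω}
    let w : (Fin (T + 1) → Bool) → ℝ := fun p => max 1 (∑ j, if p j = true then (1 : ℝ) else 0)
    have hw : ∀ p, 0 < w p := fun p => lt_max_of_lt_left one_pos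
    have hfcp : fcp (decision rule X) (capInterval n α μ rule X Y) Y T =
        fun ω => ∑ p : Fin (T + 1) → Bool, ∑ t : Fin (T + 1),
          if p t = true then (A p ∩ M t).indicator (fun _ => (w p)⁻¹) ω else 0 :=
      funext fun ω => fcp_eq_sum_path rule X _ Y T ω
    have hint : ∀ p t, Integrable
        (fun ω => if p t = true then (A p ∩ M t).indicator (fun _ => (w p)⁻¹) ω else 0) P := by
      intro p t
      by_cases hpt : p t = true
      · simp only [hpt, if_true]
        exact (integrable_const _).indicator ((key T p).2 t hpt).1
      · simp [hpt]
    refine ⟨?_, ?_⟩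
    · rw [hfcp]
      exact integrable_finsetSum _ fun p _ => integrable_finsetSum _ fun t _ => hint p t
    rw [fcr, hfcp, integral_finsetSum _ fun p _ => integrable_finsetSum _ fun t _ => hint p t]
    have htotal : ∑ p, P.real (A p) = 1 := by
      have := sum_measureReal_inter_fiber (A := Set.univ) (F := Finset.univ)
        (f := decisionPath rule X T) P (fun ω _ => Finset.mem_univ _)
        (fun p _ => by simpa using (key T p).1)
      simpa using this
    calc _ ≤ ∑ p, α * P.real (A p) := Finset.sum_le_sum fun p _ => ?_
      _ = α := by rw [← Finset.mul_sum, htotal, mul_one]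
    rw [integral_finsetSum _ fun t _ => hint p t]
    calc _ ≤ ∑ t, (if p t = true then (1 : ℝ) else 0) * ((w p)⁻¹ * (α * P.real (A p))) := by
          refine Finset.sum_le_sum fun t _ => ?_
          by_cases hpt : p t = true
          · simp only [hpt, if_true, one_mul]
            rw [integral_indicator_const _ ((key T p).2 t hpt).1, smul_eq_mul, mul_comm]
            exact mul_le_mul_of_nonneg_left ((key T p).2 t hpt).2 (inv_nonneg.2 (hw p).le)
          · simp [hpt]
      -- The number of selections on `p` is at most `w p`; this also covers the path with none.
      _ ≤ w p * ((w p)⁻¹ * (α * P.real (A p))) := by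
          rw [← Finset.sum_mul]
          refine mul_le_mul_of_nonneg_right (le_max_right _ _) ?_
          have := hw p
          positivity
      _ = α * P.real (A p) := mul_inv_cancel_left₀ (hw p).ne' _
  · set S := {ω | decision rule X t ω = true} with hS
    set C := {ω | Y t ω ∈ capInterval n α μ rule X Y t ω} with hC
    -- With horizon `t`, the selection event is the union of the paths whose last entry is `true`.
    let F : Finset (Fin (t + 1) → Bool) := Finset.univ.filter fun p => p (Fin.last t) = true
    have hF : ∀ ω ∈ S, decisionPath rule X t ω ∈ F := fun ω hω =>
      Finset.mem_filter.2 ⟨Finset.mem_univ _, hω⟩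
    have hfib : ∀ p ∈ F, S ∩ decisionPath rule X t ⁻¹' {p} = decisionPath rule X t ⁻¹' {p} := by
      intro p hp
      refine Set.inter_eq_right.2 fun ω hω => ?_
      have : decisionPath rule X t ω = p := hω
      have h := (Finset.mem_filter.1 hp).2
      rw [← this] at h
      exact h
    have hfib' : ∀ p ∈ F, S ∩ Cᶜ ∩ decisionPath rule X t ⁻¹' {p}
        = decisionPath rule X t ⁻¹' {p} ∩ Cᶜ := fun p hp => by
      rw [Set.inter_right_comm, hfib p hp]
    have hkey := fun p (hp : p ∈ F) => (key t p).2 (Fin.last t) (Finset.mem_filter.1 hp).2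
    have hA : ∀ p ∈ F, MeasurableSet (S ∩ decisionPath rule X t ⁻¹' {p}) := fun p hp => by
      rw [hfib p hp]; exact (key t p).1
    have hM : ∀ p ∈ F, MeasurableSet (S ∩ Cᶜ ∩ decisionPath rule X t ⁻¹' {p}) := fun p hp => by
      rw [hfib' p hp]; exact (hkey p hp).1
    have hle : P.real (S ∩ Cᶜ) ≤ α * P.real S :=
      measureReal_inter_le_of_inter_fiber P hF hA hM fun p hp => by
        rw [hfib' p hp, hfib p hp]; exact (hkey p hp).2
    have hSm := measurableSet_of_inter_fiber hF hA
    have hSC := measurableSet_of_inter_fiber (fun ω hω => hF ω hω.1) hM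
    have hdiff : P.real (S ∩ C) + P.real (S ∩ Cᶜ) = P.real S := by
      have := measureReal_sdiff_add_inter (μ := P) (s := S) hSC
      rwa [← Set.inter_assoc, Set.inter_self, Set.sdiff_self_inter, Set.sdiff_compl] at this
    have hSpos : 0 < P.real S := ENNReal.toReal_pos hpos.ne' (measure_ne_top _ _)
    rw [measureReal_def, cond_apply hSm, ENNReal.toReal_mul, ENNReal.toReal_inv,
      ← measureReal_def, ← measureReal_def, inv_mul_eq_div, le_div_iff₀ hSpos]
    linarith
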